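/- Let $A=\mathbb Z[\sigma_1,\sigma_2,\dots]$ be the polynomial ring over $\mathbb Z$ in countably many independent variables. A family $\mathcal S_1,\dots,\mathcal S_n$ of non-empty subsets of a group $G$ with identity $e$ is called generic if $g_{i_1}g_{i_2}\cdots g_{i_k}\neq e$ for every sequence $i_1,\dots,i_k$ of $k\ge 1$ distinct elements of $\{1,\dots,n\}$ and all $g_{i_j}\in\mathcal S_{i_j}^{-1}\mathcal S_{i_j}\setminus\{e\}$. A packing of $\mathcal S_1,\dots,\mathcal S_n$ is an element $(g_1,\dots,g_n)\in G^n$ such that the left translates $g_1\mathcal S_1,\dots,g_n\mathcal S_n$ are pairwise disjoint. Let $U=U(x,\sigma_1,\sigma_2,\dots)\in A[[x]]$ be a formal power series which counts packings of generic families in the following sense: for every $n\ge 1$, every finite group $G$ with $N$ elements and every generic family $\mathcal S_1,\dots,\mathcal S_n$ of $n$ non-empty subsets of $G$, the series $N^nU(N^{-1},\sigma_1,\sigma_2,\dots)$, in which the variables $\sigma_1,\sigma_2,\dots$ are replaced by the integers defined by $\sum_{j\ge 0}\sigma_jt^j=\prod_{k=1}^n(1+\sharp(\mathcal S_k)\,t)$,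 converges absolutely and its sum is the number of packings of $\mathcal S_1,\dots,\mathcal S_n$. **Proposition.** Every such series $U$ satisfies, in $A[[x]]$, the functional equation $$(1-\sigma_1x)\,U(x,\sigma_1,\sigma_2,\sigma_3,\dots)=U(x,\tilde\sigma_1,\tilde\sigma_2,\tilde\sigma_3,\dots),$$ where $\tilde\sigma_i=\sigma_{i-1}+\sigma_i$ for $i\ge 1$, with the convention $\sigma_0=1$. -/

import Mathlib

open scoped Pointwise

/-- The ring `A = ℤ[σ₁, σ₂, σ₃, …]`; the variable `σ i` is `MvPolynomial.X i`, for `i ≥ 1`. -/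
abbrev SigmaRing : Type := MvPolynomial ℕ+ ℤ

/-- The element `σ i` of `A` for every natural number `i`, with the convention `σ 0 = 1`. -/
noncomputable def sigma (i : ℕ) : SigmaRing :=
  if h : 0 < i then MvPolynomial.X ⟨i, h⟩ else 1

/-- The polynomial `σ̃ i = σ (i - 1) + σ i` of `A`, for `i ≥ 1`. -/
noncomputable def sigmaTilde (i : ℕ+) : SigmaRing :=
  sigma ((i : ℕ) - 1) + sigma (i : ℕ)

/-- The series `U(x, σ̃₁, σ̃₂, …)` in `A[[x]]`: the ring endomorphism `σ i ↦ σ̃ i` of `A` is applied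
to every coefficient of `U(x, σ₁, σ₂, …)`. -/
noncomputable def substTilde (U : PowerSeries SigmaRing) : PowerSeries SigmaRing :=
  PowerSeries.map (MvPolynomial.aeval sigmaTilde : SigmaRing →ₐ[ℤ] SigmaRing).toRingHom U

/-- Genericity of a family of subsets of a group: no product `g i₁ * ⋯ * g iₖ` with
`k ≥ 1` distinct indices `i₁, …, iₖ`, in any order, and with `g i ∈ (S i)⁻¹ * S i`, `g i ≠ 1`
for each of these indices, is equal to `1`. -/
def IsGenericFamily {G : Type*} [Group G] {n : ℕ} (S : Fin n → Set G) : Prop :=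
  ∀ l : List (Fin n), l ≠ [] → l.Nodup →
    ∀ g : Fin n → G, (∀ i ∈ l, g i ∈ ((S i)⁻¹ * S i) \ {1}) → (l.map g).prod ≠ 1

/-- The packings of `S 1, …, S n`: the `(g 1, …, g n) ∈ G ^ n` such that the left translates
`g i • S i` are pairwise disjoint. -/
def packings {G : Type*} [Group G] {n : ℕ} (S : Fin n → Set G) : Set (Fin n → G) :=
  {g | Pairwise fun i j => Disjoint (g i • S i) (g j • S j)}

/-- The integers `σ j` attached to a finite family of natural numbers `s k`, given by
`∑ j, σ j * t ^ j = ∏ k, (1 + s k * t)`. -/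
noncomputable def sigmaValue {n : ℕ} (s : Fin n → ℕ) (j : ℕ) : ℤ :=
  (∏ k, (1 + Polynomial.C (s k : ℤ) * Polynomial.X)).coeff j

/-- `U ∈ A[[x]]` counts packings of generic families: for every generic family `S 1, …, S n` of
`n ≥ 1` non-empty subsets of a finite group `G` with `N` elements, the series
`N ^ n * U(1 / N, σ₁, σ₂, …)`, with the `σ j` evaluated on the cardinalities of the `S k`,
converges (as a series of real numbers), and its sum is the number of packings. -/
def IsPackingCountingSeries (U : PowerSeries SigmaRing) : Prop :=
  ∀ (G : Type) [Group G] [Finite G] (n : ℕ) (S : Fin n → Set G),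
    1 ≤ n → (∀ i, (S i).Nonempty) → IsGenericFamily S →
    HasSum
      (fun m : ℕ => (Nat.card G : ℝ) ^ n *
        ((MvPolynomial.eval (fun j : ℕ+ => sigmaValue (fun k => (S k).ncard) j)
          (PowerSeries.coeff m U) : ℤ) * ((Nat.card G : ℝ)⁻¹) ^ m))
      ((packings S).ncard : ℝ)

/-! Adjoin the singleton `{1}` to a generic family. It stays generic, the factor `1 + t` turns each
`σ i` into `σ̃ i`, and every packing extends in exactly `N - σ 1` ways, since the disjoint
translates cover `σ 1` elements. Dividing by `N ^ (n + 1)` gives the functional equation at `x = 1 /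
N`. For fixed sizes, cyclic groups provide generic families for all large `N`
(`exists_isGenericFamily_zmod`). The difference of the two sides, evaluated at these sizes, thus
vanishes at points tending to `0`, so all its coefficients vanish
(`eq_zero_of_eventually_hasSum_inv_natCast`). Algebraic independence of the elementary symmetric
polynomials lifts this to `A` (`eq_zero_of_eval_sigmaValue_eq_zero`). -/

/-! ### Evaluating polynomials in the `σ i` -/

theorem MvPolynomial.eval_aeval_eq {ι κ R : Type*} [CommSemiring R] (x : κ → R)
    (g : ι → MvPolynomial κ R) (F : MvPolynomial ι R) :
    MvPolynomial.eval x (MvPolynomial.aeval g F) =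
      MvPolynomial.eval (fun i => MvPolynomial.eval x (g i)) F := by
  induction F using MvPolynomial.induction_on with
  | C a => simp
  | add p q hp hq => simp only [map_add, hp, hq]
  | mul_X p i hp => simp only [map_mul, hp, MvPolynomial.aeval_X, MvPolynomial.eval_X]

/-- The integers `σ j` attached to `s` are the values of the elementary symmetric polynomials. -/
theorem sigmaValue_eq_eval_esymm {n : ℕ} (s : Fin n → ℕ) (j : ℕ) :
    sigmaValue s j =
      MvPolynomial.eval (fun k => (s k : ℤ)) (MvPolynomial.esymm (Fin n) ℤ j) := by
  classical
  have h : ∀ t : Finset (Fin n), (∏ k ∈ t, (Polynomial.C (s k : ℤ) * Polynomial.X)) =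
      Polynomial.C (∏ k ∈ t, (s k : ℤ)) * Polynomial.X ^ t.card := by
    intro t
    rw [Finset.prod_mul_distrib, map_prod, Finset.prod_const]
  rw [sigmaValue, Finset.prod_one_add, Polynomial.finsetSum_coeff]
  simp only [h, Polynomial.coeff_C_mul, Polynomial.coeff_X_pow, mul_ite, mul_one, mul_zero]
  rw [← Finset.sum_filter, MvPolynomial.esymm, map_sum]
  simp only [map_prod, MvPolynomial.eval_X]
  refine Finset.sum_congr ?_ fun _ _ => rfl
  ext t
  simp [Finset.mem_powersetCard, eq_comm]

theorem sigmaValue_zero {n : ℕ} (s : Fin n → ℕ) : sigmaValue s 0 = 1 := by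
  simp [sigmaValue_eq_eval_esymm]

theorem sigmaValue_one {n : ℕ} (s : Fin n → ℕ) : sigmaValue s 1 = ∑ k, (s k : ℤ) := by
  simp [sigmaValue_eq_eval_esymm, MvPolynomial.esymm_one]

theorem sigmaValue_cons_one {n : ℕ} (s : Fin n → ℕ) (j : ℕ) :
    sigmaValue (Fin.cons 1 s : Fin (n + 1) → ℕ) (j + 1) =
      sigmaValue s j + sigmaValue s (j + 1) := by
  simp only [sigmaValue, Fin.prod_univ_succ, Fin.cons_zero, Fin.cons_succ, add_mul, one_mul,
    Polynomial.coeff_add, Nat.cast_one, map_one, Polynomial.coeff_X_mul]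
  ring

theorem eval_sigma {n : ℕ} (s : Fin n → ℕ) (j : ℕ) :
    MvPolynomial.eval (fun i : ℕ+ => sigmaValue s i) (sigma j) = sigmaValue s j := by
  rcases Nat.eq_zero_or_pos j with rfl | h
  · simp [sigma, sigmaValue_zero]
  · rw [sigma, dif_pos h]
    exact MvPolynomial.eval_X (⟨j, h⟩ : ℕ+)

/-- Evaluating after the substitution `σ i ↦ σ̃ i` amounts to adjoining the number `1`. -/
theorem eval_aeval_sigmaTilde {n : ℕ} (s : Fin n → ℕ) (F : SigmaRing) :
    MvPolynomial.eval (fun i : ℕ+ => sigmaValue s i) (MvPolynomial.aeval sigmaTilde F) =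
      MvPolynomial.eval
        (fun i : ℕ+ => sigmaValue (Fin.cons 1 s : Fin (n + 1) → ℕ) i) F := by
  have hv : (fun i : ℕ+ => sigmaValue (Fin.cons 1 s : Fin (n + 1) → ℕ) i) =
      fun i : ℕ+ => MvPolynomial.eval (fun i : ℕ+ => sigmaValue s i) (sigmaTilde i) := by
    funext i
    obtain ⟨j, hj⟩ := Nat.exists_eq_succ_of_ne_zero i.ne_zero
    simp only [sigmaTilde, map_add, eval_sigma, hj]
    simpa using sigmaValue_cons_one s j
  rw [hv, MvPolynomial.eval_aeval_eq]

/-- A polynomial in the `σ i` is determined by its values on families of positive integers. -/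
theorem eq_zero_of_eval_sigmaValue_eq_zero (F : SigmaRing)
    (h : ∀ (n : ℕ) (s : Fin n → ℕ), 1 ≤ n → (∀ k, 1 ≤ s k) →
      MvPolynomial.eval (fun i : ℕ+ => sigmaValue s i) F = 0) : F = 0 := by
  -- With `n` at least every index in `F`, only `σ 1, …, σ n` occur, and these match the independent
  -- elementary symmetric polynomials in `n` variables; the `+ 1` covers constant `F`.
  obtain ⟨n, hn, hF⟩ : ∃ n : ℕ, 1 ≤ n ∧ ∀ i ∈ F.vars, (i : ℕ) ≤ n :=
    ⟨F.vars.sup (fun i => (i : ℕ)) + 1, by omega,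
      fun i hi => (Finset.le_sup (f := fun i : ℕ+ => (i : ℕ)) hi).trans (Nat.le_succ _)⟩
  let f : Fin n → ℕ+ := fun i => ⟨i + 1, i.1.succ_pos⟩
  have hf : Function.Injective f := by
    intro a b hab
    have : (a : ℕ) + 1 = b + 1 := congrArg PNat.val hab
    exact Fin.ext (by omega)
  obtain ⟨q, rfl⟩ := MvPolynomial.exists_rename_eq_of_vars_subset_range F f hf (by
    intro i hi
    have h1 := hF i hi
    have h2 := i.pos
    exact ⟨⟨i - 1, by omega⟩, PNat.eq (by simp [f]; omega)⟩)
  suffices hq : q = 0 by simp [hq]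
  apply MvPolynomial.esymmAlgHom_fin_injective ℤ (le_refl n)
  rw [map_zero]
  apply Subtype.ext
  rw [MvPolynomial.esymmAlgHom_apply]
  -- A polynomial vanishing on a product of infinite sets is zero.
  refine MvPolynomial.funext_set (fun _ => Set.range fun m : ℕ => ((m + 1 : ℕ) : ℤ))
    (fun _ => Set.infinite_range_of_injective fun a b hab => by simpa using hab) ?_
  intro x hx
  choose s hs using fun k => hx k (Set.mem_univ k)
  obtain rfl : (fun k => ((s k + 1 : ℕ) : ℤ)) = x := funext hs
  have := h n (fun k => s k + 1) hn (fun k => by omega)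
  rw [MvPolynomial.eval_rename] at this
  rw [MvPolynomial.eval_aeval_eq, ZeroMemClass.coe_zero, map_zero, ← this]
  congr 2
  funext i
  exact (sigmaValue_eq_eval_esymm _ _).symm

/-! ### Adjoining a singleton -/

/-- The set `{1}⁻¹ * {1} \ {1}` is empty, so the new index never occurs in a forbidden product. -/
theorem isGenericFamily_cons_one {G : Type*} [Group G] {n : ℕ} {S : Fin n → Set G}
    (hS : IsGenericFamily S) : IsGenericFamily (Fin.cons {1} S : Fin (n + 1) → Set G) := by
  intro l hl hnd g hg
  have h0 : ∀ i ∈ l, i ≠ 0 := by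
    rintro i hi rfl
    simpa using hg 0 hi
  obtain ⟨l', rfl⟩ : ∃ l' : List (Fin n), l'.map Fin.succ = l :=
    ⟨l.pmap (fun i hi => i.pred hi) h0, by simp [List.map_pmap]⟩
  rw [List.map_map]
  refine hS l' (by simpa using hl) (List.Nodup.of_map _ hnd) _ fun i hi => ?_
  simpa using hg i.succ (List.mem_map_of_mem hi)

theorem mem_packings_cons_one {G : Type*} [Group G] {n : ℕ} {S : Fin n → Set G}
    (g : Fin (n + 1) → G) :
    g ∈ packings (Fin.cons {1} S : Fin (n + 1) → Set G) ↔
      Fin.tail g ∈ packings S ∧ g 0 ∉ ⋃ i, Fin.tail g i • S i := by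
  simp only [packings, Set.mem_ofPred_eq, Pairwise, Fin.forall_fin_succ, Fin.cons_zero,
    Fin.cons_succ, Fin.tail, ne_eq, not_true, Fin.succ_inj, Set.mem_iUnion, not_exists,
    Set.smul_set_singleton, smul_eq_mul, mul_one, Set.disjoint_singleton_left,
    Set.disjoint_singleton_right]
  refine ⟨fun h => ⟨fun i j hij => (h.2 i).2 j hij, fun i => h.1.2 i (Fin.succ_ne_zero i).symm⟩,
    fun h => ⟨⟨fun h => h.elim, fun i _ => h.2 i⟩,
      fun i => ⟨fun _ => h.2 i, fun j hij => h.1 hij⟩⟩⟩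

/-- Adjoining a singleton to a family: each packing of the family extends by any element outside
the translates. -/
theorem ncard_packings_cons_one {G : Type*} [Group G] [Finite G] {n : ℕ} (S : Fin n → Set G) :
    ((packings (Fin.cons {1} S : Fin (n + 1) → Set G)).ncard : ℤ) =
      (packings S).ncard * (Nat.card G - ∑ i, ((S i).ncard : ℤ)) := by
  classical
  have := Fintype.ofFinite (packings S)
  let e : packings (Fin.cons {1} S : Fin (n + 1) → Set G) ≃
      Σ g : packings S, ((⋃ i, g.1 i • S i)ᶜ : Set G) :=
    { toFun := fun g => ⟨⟨Fin.tail g.1, ((mem_packings_cons_one g.1).1 g.2).1⟩,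
        ⟨g.1 0, ((mem_packings_cons_one g.1).1 g.2).2⟩⟩
      invFun := fun p => ⟨Fin.cons p.2.1 p.1.1, (mem_packings_cons_one _).2 ⟨p.1.2, p.2.2⟩⟩
      left_inv := fun g => Subtype.ext (Fin.cons_self_tail g.1)
      right_inv := fun p => rfl }
  have hfib : ∀ g : packings S, (Nat.card ((⋃ i, g.1 i • S i)ᶜ : Set G) : ℤ) =
      Nat.card G - ∑ i, ((S i).ncard : ℤ) := by
    intro g
    have h1 := Set.ncard_add_ncard_compl (⋃ i, g.1 i • S i)
    have h2 : (⋃ i, g.1 i • S i).ncard = ∑ i, (S i).ncard := by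
      rw [Set.ncard_iUnion_of_finite (fun i => Set.toFinite _) g.2, finsum_eq_sum_of_fintype]
      simp [Set.ncard_smul_set]
    rw [Nat.card_coe_set_eq, eq_sub_iff_add_eq]
    rw [h2] at h1
    exact_mod_cast (add_comm _ _).trans h1
  rw [← Nat.card_coe_set_eq, Nat.card_congr e, Nat.card_sigma]
  push_cast
  rw [Finset.sum_congr rfl fun g _ => hfib g, Finset.sum_const, Finset.card_univ, nsmul_eq_mul,
    ← Nat.card_eq_fintype_card, Nat.card_coe_set_eq]

/-! ### Power series at the points `1 / N` -/

open Filter Topology in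
/-- A power series that sums to `0` at `1 / N` for all large `N` is zero. -/
theorem eq_zero_of_eventually_hasSum_inv_natCast (a : ℕ → ℝ)
    (h : ∀ᶠ N : ℕ in atTop, HasSum (fun m => a m * ((N : ℝ)⁻¹) ^ m) 0) : a = 0 := by
  obtain ⟨N₀, hN₀⟩ := eventually_atTop.1 h
  by_contra hne
  have hex : ∃ m, a m ≠ 0 := by
    by_contra hcon
    exact hne (funext fun m => by simpa using not_exists.1 hcon m)
  classical
  let k := Nat.find hex
  have hk : a k ≠ 0 := Nat.find_spec hex
  have hlt : ∀ m < k, a m = 0 := fun m hm => by simpa using Nat.find_min hex hm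
  -- Divide by the lowest power `x ^ k` present; the constant term is now `a k ≠ 0`.
  have hsum : ∀ N : ℕ, N₀ ≤ N → 1 ≤ N → HasSum (fun m => a (m + k) * ((N : ℝ)⁻¹) ^ m) 0 := by
    intro N hN hN1
    have hN' : (N : ℝ) ≠ 0 := by positivity
    have h1 := (hasSum_nat_add_iff' (f := fun m => a m * ((N : ℝ)⁻¹) ^ m) k).2 (hN₀ N hN)
    rw [Finset.sum_eq_zero (fun m hm => by rw [hlt m (Finset.mem_range.1 hm), zero_mul]),
      sub_zero] at h1
    have h2 := h1.mul_left ((N : ℝ) ^ k)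
    rw [mul_zero] at h2
    refine h2.congr_fun ?_
    intro m
    rw [pow_add, inv_pow _ k]
    field_simp
  have hlim : Tendsto (fun N : ℕ => ∑' m, a (m + k) * ((N : ℝ)⁻¹) ^ m) atTop
      (𝓝 (∑' m, a (m + k) * (0 : ℝ) ^ m)) := by
    -- The terms at `1 / (N₀ + 1)` dominate those at all later `1 / N`.
    refine tendsto_tsum_of_dominated_convergence
      (hsum (N₀ + 1) (by omega) (by omega)).summable.norm (fun m => ?_) ?_
    · exact (tendsto_inv_atTop_nhds_zero_nat.pow m).const_mul _
    · filter_upwards [eventually_ge_atTop (N₀ + 1)] with N hN m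
      rw [norm_mul, norm_mul, norm_pow, norm_pow]
      gcongr
      rw [Real.norm_of_nonneg (by positivity), Real.norm_of_nonneg (by positivity)]
      gcongr
  have h0 : (∑' m, a (m + k) * (0 : ℝ) ^ m) = a k := by
    rw [tsum_eq_single 0 (fun m hm => by simp [hm])]
    simp
  have hz : Tendsto (fun N : ℕ => ∑' m, a (m + k) * ((N : ℝ)⁻¹) ^ m) atTop (𝓝 0) := by
    refine tendsto_const_nhds.congr' ?_
    filter_upwards [eventually_ge_atTop (N₀ + 1)] with N hN
    exact (hsum N (by omega) (by omega)).tsum_eq.symm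
  rw [h0] at hlim
  exact hk (tendsto_nhds_unique hlim hz)

/-- Evaluation of `(1 - c x) P` from that of `P`. -/
theorem hasSum_coeff_one_sub_C_mul_X_mul {P : PowerSeries ℤ} {x S : ℝ} (c : ℤ)
    (h : HasSum (fun m => ((PowerSeries.coeff m P : ℤ) : ℝ) * x ^ m) S) :
    HasSum (fun m =>
      ((PowerSeries.coeff m ((1 - PowerSeries.C c * PowerSeries.X) * P) : ℤ) : ℝ) * x ^ m)
      ((1 - c * x) * S) := by
  have h' : HasSum (fun m =>
      ((PowerSeries.coeff m (PowerSeries.C c * PowerSeries.X * P) : ℤ) : ℝ) * x ^ m) (c * x * S) := by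
    rw [← hasSum_nat_add_iff' 1]
    simp only [mul_assoc, PowerSeries.coeff_C_mul, PowerSeries.coeff_succ_X_mul, Finset.range_one,
      Finset.sum_singleton, PowerSeries.coeff_zero_X_mul, mul_zero, Int.cast_zero, zero_mul,
      sub_zero, Int.cast_mul]
    rw [← mul_assoc]
    refine (h.mul_left (c * x)).congr_fun fun m => ?_
    ring
  have hsub := h.sub h'
  rw [show S - c * x * S = (1 - c * x) * S by ring] at hsub
  refine hsub.congr_fun fun m => ?_
  rw [sub_mul, one_mul, map_sub, Int.cast_sub, sub_mul]

/-! ### Generic families in cyclic groups -/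

/-- Integers with non-zero digits of size less than `M` in base `M` do not vanish. -/
theorem sum_mul_pow_ne_zero {n : ℕ} {M : ℤ} (hM : 0 < M) {T : Finset (Fin n)} (hT : T.Nonempty)
    (d : Fin n → ℤ) (hd : ∀ i ∈ T, d i ≠ 0 ∧ |d i| < M) : ∑ i ∈ T, d i * M ^ (i : ℕ) ≠ 0 := by
  intro h
  -- All terms but the lowest are divisible by `M ^ (k + 1)`, which forces `M ∣ d k`.
  set k := T.min' hT
  have hk : k ∈ T := T.min'_mem hT
  rw [← Finset.add_sum_erase T _ hk] at h
  have hdvd : M ^ ((k : ℕ) + 1) ∣ ∑ i ∈ T.erase k, d i * M ^ (i : ℕ) := by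
    refine Finset.dvd_sum fun i hi => Dvd.dvd.mul_left (pow_dvd_pow M ?_) _
    have h1 := T.min'_le i (Finset.mem_of_mem_erase hi)
    exact Nat.succ_le_of_lt (lt_of_le_of_ne h1 fun h => Finset.ne_of_mem_erase hi (Fin.ext h.symm))
  have h2 : M ^ (k : ℕ) * M ∣ M ^ (k : ℕ) * d k := by
    rw [← pow_succ, mul_comm _ (d k), eq_neg_of_add_eq_zero_left h]
    exact hdvd.neg_right
  have h3 : M ∣ d k := (mul_dvd_mul_iff_left (pow_pos hM _).ne').1 h2
  exact (hd k hk).1 (Int.eq_zero_of_abs_lt_dvd h3 (hd k hk).2)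

/-- Generic families of arbitrary sizes exist in all large finite cyclic groups. -/
theorem exists_isGenericFamily_zmod {n : ℕ} (s : Fin n → ℕ) :
    ∃ N₀ : ℕ, ∀ N : ℕ, N₀ ≤ N → ∃ S : Fin n → Set (Multiplicative (ZMod N)),
      IsGenericFamily S ∧ ∀ i, (S i).ncard = s i := by
  obtain ⟨M, hM0, hM⟩ : ∃ M : ℕ, 0 < M ∧ ∀ i, s i ≤ M :=
    ⟨(∑ i, s i) + 1, by omega,
      fun i => (Finset.single_le_sum (fun _ _ => Nat.zero_le _) (Finset.mem_univ i)).trans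
        (Nat.le_succ _)⟩
  -- `N` exceeds every digit sum below in absolute value, so vanishing modulo `N` means vanishing in
  -- `ℤ`.
  refine ⟨∑ i : Fin n, M * M ^ (i : ℕ) + 1, fun N hN => ?_⟩
  -- The `i`-th set consists of the multiples `a * M ^ i` with `a < s i ≤ M`; its differences only
  -- involve the `i`-th digit in base `M`.
  refine ⟨fun i => (fun a : ℕ => Multiplicative.ofAdd ((a * M ^ (i : ℕ) : ℕ) : ZMod N)) ''
    Set.Iio (s i), ?_, fun i => ?_⟩
  · intro l hl hnd g hg hprod
    have hex : ∀ i ∈ l, ∃ d : ℤ, d ≠ 0 ∧ |d| < M ∧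
        g i = Multiplicative.ofAdd ((d * (M : ℤ) ^ (i : ℕ) : ℤ) : ZMod N) := by
      intro i hi
      obtain ⟨⟨u, hu, v, ⟨b, hb, rfl⟩, huv⟩, hne⟩ := hg i hi
      obtain ⟨a, ha, hau⟩ := Set.mem_inv.1 hu
      have hb' := hb.out.trans_le (hM i)
      have ha' := ha.out.trans_le (hM i)
      have hgi : g i = Multiplicative.ofAdd
          ((((b : ℤ) - a) * (M : ℤ) ^ (i : ℕ) : ℤ) : ZMod N) := by
        rw [← huv, ← inv_inv u, ← hau]
        simp only [← ofAdd_neg, ← ofAdd_add]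
        congr 1
        push_cast
        ring
      refine ⟨(b : ℤ) - a, fun h0 => hne ?_, by rw [abs_lt]; omega, hgi⟩
      rw [hgi, h0]
      simp
    choose! d hd0 hdM hgd using hex
    have hT : l.toFinset.Nonempty := by simpa using hl
    refine sum_mul_pow_ne_zero (M := (M : ℤ)) (by exact_mod_cast hM0) hT d
      (fun i hi => ⟨hd0 i (by simpa using hi), hdM i (by simpa using hi)⟩) ?_
    rw [← List.prod_toFinset g hnd, Finset.prod_congr rfl
      (fun i hi => hgd i (List.mem_toFinset.1 hi)), ← ofAdd_sum, ← Int.cast_sum, ofAdd_eq_one,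
      ZMod.intCast_zmod_eq_zero_iff_dvd] at hprod
    refine Int.eq_zero_of_abs_lt_dvd hprod ?_
    calc |∑ i ∈ l.toFinset, d i * (M : ℤ) ^ (i : ℕ)|
        ≤ ∑ i ∈ l.toFinset, (M : ℤ) * (M : ℤ) ^ (i : ℕ) := by
          refine (Finset.abs_sum_le_sum_abs _ _).trans (Finset.sum_le_sum fun i hi => ?_)
          rw [abs_mul, abs_of_nonneg (by positivity : (0 : ℤ) ≤ (M : ℤ) ^ (i : ℕ))]
          exact mul_le_mul_of_nonneg_right (hdM i (by simpa using hi)).le (by positivity)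
      _ ≤ ∑ i : Fin n, (M : ℤ) * (M : ℤ) ^ (i : ℕ) :=
          Finset.sum_le_sum_of_subset_of_nonneg (Finset.subset_univ _)
            fun _ _ _ => by positivity
      _ < N := by exact_mod_cast hN
  · rw [Set.InjOn.ncard_image, ← Finset.coe_Iio, Set.ncard_coe_finset, Nat.card_Iio]
    have hlt : ∀ a < s i, a * M ^ (i : ℕ) < N := fun a ha =>
      calc a * M ^ (i : ℕ) ≤ M * M ^ (i : ℕ) := Nat.mul_le_mul_right _ (ha.le.trans (hM i))
        _ ≤ ∑ i : Fin n, M * M ^ (i : ℕ) :=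
          Finset.single_le_sum (f := fun i : Fin n => M * M ^ (i : ℕ))
            (fun _ _ => Nat.zero_le _) (Finset.mem_univ i)
        _ < N := hN
    intro a ha b hb hab
    have h := (ZMod.natCast_eq_natCast_iff' _ _ _).1 (Multiplicative.ofAdd.injective hab)
    rw [Nat.mod_eq_of_lt (hlt a ha), Nat.mod_eq_of_lt (hlt b hb)] at h
    exact Nat.eq_of_mul_eq_mul_right (by positivity) h

/-! ### The functional equation -/

/-- The functional equation at `x = 1 / N`, expressed through the packings of a generic family and
of the same family with a singleton adjoined. -/
theorem IsPackingCountingSeries.hasSum_cons_one {U : PowerSeries SigmaRing}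
    (hU : IsPackingCountingSeries U) {G : Type} [Group G] [Finite G] {n : ℕ} (hn : 1 ≤ n)
    {S : Fin n → Set G} (hne : ∀ i, (S i).Nonempty) (hS : IsGenericFamily S) {s : Fin n → ℕ}
    (hs : ∀ i, (S i).ncard = s i) :
    HasSum (fun m : ℕ =>
      ((MvPolynomial.eval (fun j : ℕ+ => sigmaValue s j) (PowerSeries.coeff m
        ((1 - PowerSeries.C (sigma 1) * PowerSeries.X) * U - substTilde U)) : ℤ) : ℝ) *
          ((Nat.card G : ℝ)⁻¹) ^ m) 0 := by
  have hN : (Nat.card G : ℝ) ≠ 0 := Nat.cast_ne_zero.2 Nat.card_pos.ne'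
  have h1 := hU G n S hn hne hS
  have h2 := hU G (n + 1) (Fin.cons {1} S) (by omega)
    (Fin.forall_fin_succ.2 ⟨by simp, by simpa using hne⟩) (isGenericFamily_cons_one hS)
  have hs2 : (fun k => ((Fin.cons {1} S : Fin (n + 1) → Set G) k).ncard) = Fin.cons 1 s :=
    funext (Fin.forall_fin_succ.2 ⟨by simp, by simpa using hs⟩)
  have hcard : ((packings (Fin.cons {1} S : Fin (n + 1) → Set G)).ncard : ℝ) =
      (packings S).ncard * (Nat.card G - (sigmaValue s 1 : ℤ)) := by
    rw [sigmaValue_one, ← funext hs]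
    exact_mod_cast ncard_packings_cons_one S
  rw [funext hs] at h1
  rw [hs2, hcard] at h2
  replace h1 := h1.mul_left (((Nat.card G : ℝ) ^ n)⁻¹)
  replace h2 := h2.mul_left (((Nat.card G : ℝ) ^ (n + 1))⁻¹)
  simp only [inv_mul_cancel_left₀ (pow_ne_zero _ hN)] at h1 h2
  replace h1 := hasSum_coeff_one_sub_C_mul_X_mul (sigmaValue s 1)
    (P := PowerSeries.map (MvPolynomial.eval fun j : ℕ+ => sigmaValue s j) U)
    (by simpa only [PowerSeries.coeff_map] using h1)
  have hsub := h1.sub h2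
  have hzero : (1 - (sigmaValue s 1 : ℝ) * (Nat.card G : ℝ)⁻¹) *
      (((Nat.card G : ℝ) ^ n)⁻¹ * (packings S).ncard) -
      ((Nat.card G : ℝ) ^ (n + 1))⁻¹ * ((packings S).ncard * (Nat.card G - (sigmaValue s 1 : ℤ))) =
        0 := by
    rw [pow_succ]
    field_simp
    ring
  rw [hzero] at hsub
  refine hsub.congr_fun fun m => ?_
  rw [← sub_mul, ← Int.cast_sub, map_sub, map_sub, ← PowerSeries.coeff_map,
    map_mul (PowerSeries.map _), map_sub (PowerSeries.map _), map_mul (PowerSeries.map _),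
    map_one, PowerSeries.map_C, PowerSeries.map_X, eval_sigma, substTilde,
    PowerSeries.coeff_map, ← eval_aeval_sigmaTilde]
  rfl

theorem proposition2p3 (U : PowerSeries SigmaRing) (hU : IsPackingCountingSeries U) :
    (1 - PowerSeries.C (sigma 1) * PowerSeries.X) * U = substTilde U := by
  rw [← sub_eq_zero]
  ext1 m
  rw [map_zero]
  refine eq_zero_of_eval_sigmaValue_eq_zero _ fun n s hn hs => ?_
  obtain ⟨N₀, hN₀⟩ := exists_isGenericFamily_zmod s
  have h := eq_zero_of_eventually_hasSum_inv_natCast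
    (fun m => ((MvPolynomial.eval (fun j : ℕ+ => sigmaValue s j) (PowerSeries.coeff m
        ((1 - PowerSeries.C (sigma 1) * PowerSeries.X) * U - substTilde U)) : ℤ) : ℝ)) (by
      -- `N = 0` is discarded because `ZMod 0` is infinite.
      filter_upwards [Filter.eventually_ge_atTop N₀, Filter.eventually_gt_atTop 0] with N hN hpos
      have : NeZero N := ⟨hpos.ne'⟩
      obtain ⟨S, hS, hcard⟩ := hN₀ N hN
      have hsum := hU.hasSum_cons_one hn (fun i => Set.nonempty_of_ncard_ne_zero (by
        rw [hcard i]
        exact Nat.one_le_iff_ne_zero.1 (hs i))) hS hcard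
      rwa [Nat.card_congr Multiplicative.toAdd, Nat.card_zmod] at hsum)
  exact Int.cast_eq_zero.1 (congrFun h m)
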